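/- Let $M$ be a smooth manifold with a smooth Riemannian metric $g$ and three smooth integrable complex structures $I,J,K$ (endomorphism fields of $TM$ with square $-1$ and vanishing Nijenhuis tensor) such that $IJ=K$, $JK=I$, $KI=J$ and $g$ is Hermitian with respect to each of them. For a complex structure $A\in\{I,J,K\}$, a Bismut connection of $(g,A)$ is an affine connection $\hat\nabla$ on $M$ with $\hat\nabla g=0$ and $\hat\nabla A=0$ whose torsion $T$ is such that $C(u,v,w)=g(u,T(v,w))$ is totally antisymmetric; $C$ is then the Bismut torsion of $(g,A)$. Assume that $(M,g,I,J,K)$ is an HKT manifold: the Bismut torsions of $(g,I)$, $(g,J)$ and $(g,K)$ coincide. Put $\Omega_A=A_{MN}\,dx^M\wedge dx^N$ with $A_{MN}u^Mv^N=g(u,Av)$, that is, $\Omega_A(u,v)=g(u,Av)-g(v,Au)=2g(u,Av)$. For an $n$-form $\alpha$ put $(\iota\alpha)(v_1,\dots,v_n)=\sum_{k}\alpha(v_1,\dots,Iv_k,\dots,v_n)$, $d_I\alpha=d(\iota\alpha)-\iota(d\alpha)$ and, for complex-valued $\alpha$, $\partial_I\alpha=\tfrac12(d\alpha+i\,d_I\alpha)$,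 which on forms of type $(p,q)$ with respect to $I$ is the component of type $(p+1,q)$ of $d\alpha$. Theorem. The complex-valued form $\Omega_J+i\Omega_K$ is of type $(2,0)$ with respect to $I$, and it is $\partial_I$-closed: $$\partial_I(\Omega_J+i\Omega_K)=0 ,$$ so $d(\Omega_J+i\Omega_K)$ is of type $(2,1)$. Equivalently, $$d\Omega_J=d_I\Omega_K,\qquad d\Omega_K=-d_I\Omega_J .$$ -/

import Mathlib

open scoped Manifold ContDiff
open Bundle

noncomputable section

namespace HKT

section Forms

variable {E : Type*} [NormedAddCommGroup E] [NormedSpace ℝ E]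
  {M : Type*} [TopologicalSpace M] [ChartedSpace E M]
  {F : Type*} [NormedAddCommGroup F] [NormedSpace ℝ F]

variable (E M) in
/-- Fields of endomorphisms of the tangent spaces of `M`, that is, tensor fields `I^N_M`. -/
abbrev EndField : Type _ :=
  ∀ x : M, TangentSpace 𝓘(ℝ, E) x →L[ℝ] TangentSpace 𝓘(ℝ, E) x

variable (E M F) in
/-- `F`-valued differential forms of degree `n` on `M` (here `F` is `ℝ` or `ℂ`), without any
regularity requirement. -/
abbrev DForm (n : ℕ) : Type _ :=
  ∀ x : M, TangentSpace 𝓘(ℝ, E) x [⋀^Fin n]→L[ℝ] F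

/-- The expression of a differential form in the chart `extChartAt 𝓘(ℝ, E) x₀`: its pullback to
the model space `E` along the inverse of the chart. -/
def DForm.inChart {n : ℕ} (α : DForm E M F n) (x₀ : M) (y : E) : E [⋀^Fin n]→L[ℝ] F :=
  (α ((extChartAt 𝓘(ℝ, E) x₀).symm y)).compContinuousLinearMap
    (mfderiv 𝓘(ℝ, E) 𝓘(ℝ, E) (extChartAt 𝓘(ℝ, E) x₀).symm y)

/-- The exterior derivative on the manifold `M`: express the form in the preferred chart at `x`,
take the exterior derivative on the model space there, and pull the result back along the chart. -/
def dExt {n : ℕ} (α : DForm E M F n) : DForm E M F (n + 1) := fun x ↦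
  (extDeriv (α.inChart x) (extChartAt 𝓘(ℝ, E) x x)).compContinuousLinearMap
    (mfderiv 𝓘(ℝ, E) 𝓘(ℝ, E) (extChartAt 𝓘(ℝ, E) x) x)

end Forms

section Iota

variable {V : Type*} [AddCommGroup V] [Module ℝ V] [TopologicalSpace V]
  {F : Type*} [NormedAddCommGroup F] [NormedSpace ℝ F]

/-- `(ι α)(v₁, …, vₙ) = ∑ₖ α(v₁, …, A vₖ, …, vₙ)` for an alternating form `α` and an endomorphism
`A` of one vector space. -/
def iotaAt {n : ℕ} (A : V →L[ℝ] V) (α : V [⋀^Fin n]→L[ℝ] F) : V [⋀^Fin n]→L[ℝ] F where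
  toContinuousMultilinearMap := ∑ k : Fin n,
    α.toContinuousMultilinearMap.compContinuousLinearMap
      (Function.update (fun _ ↦ ContinuousLinearMap.id ℝ V) k A)
  map_eq_zero_of_eq' := by
    intro v i j hv hij
    have key : ∀ k : Fin n,
        (α.toContinuousMultilinearMap.compContinuousLinearMap
          (Function.update (fun _ ↦ ContinuousLinearMap.id ℝ V) k A)) v
          = α (Function.update v k (A (v k))) := by
      intro k
      have : (fun l ↦ (Function.update (fun _ ↦ ContinuousLinearMap.id ℝ V) k A) l (v l))
          = Function.update v k (A (v k)) := by
        funext l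
        by_cases h : l = k
        · subst h; simp
        · simp [h]
      rw [ContinuousMultilinearMap.compContinuousLinearMap_apply, this]
      rfl
    change (∑ k : Fin n, α.toContinuousMultilinearMap.compContinuousLinearMap
      (Function.update (fun _ ↦ ContinuousLinearMap.id ℝ V) k A)) v = 0
    rw [_root_.sum_apply, Finset.sum_congr rfl (fun k _ ↦ key k),
      ← Finset.sum_subset (Finset.subset_univ {i, j})]
    · rw [Finset.sum_pair hij]
      have hs : Function.update v j (A (v j))
          = Function.update v i (A (v i)) ∘ Equiv.swap i j := by
        funext l
        by_cases h1 : l = i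
        · subst h1; simp [hij, hv, Ne.symm hij]
        · by_cases h2 : l = j
          · subst h2; simp [hv]
          · simp [h1, h2, Equiv.swap_apply_of_ne_of_ne]
      rw [hs]
      have := α.toAlternatingMap.map_swap (Function.update v i (A (v i))) hij
      simp only [ContinuousAlternatingMap.coe_toAlternatingMap] at this
      rw [this]
      simp
    · intro k _ hk
      simp only [Finset.mem_insert, Finset.mem_singleton, not_or] at hk
      refine α.map_eq_zero_of_eq _ ?_ hij
      simp [Function.update_of_ne (Ne.symm hk.1), Function.update_of_ne (Ne.symm hk.2), hv]

end Iota

section Geometry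

variable {E : Type*} [NormedAddCommGroup E] [NormedSpace ℝ E]
  {M : Type*} [TopologicalSpace M] [ChartedSpace E M]
  {F : Type*} [NormedAddCommGroup F] [NormedSpace ℝ F]

/-- The operator `ι` on forms associated with the endomorphism field `I`. -/
def iota {n : ℕ} (I : EndField E M) (α : DForm E M F n) : DForm E M F n :=
  fun x ↦ iotaAt (I x) (α x)

/-- The operator `d_I = [d, ι]`. -/
def dTwist {n : ℕ} (I : EndField E M) (α : DForm E M F n) : DForm E M F (n + 1) :=
  fun x ↦ dExt (iota I α) x - iota I (dExt α) x

/-- The holomorphic exterior derivative `∂_I = (d + i d_I) / 2` on complex-valued forms: for an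
integrable `I` and a form `α` of type `(p, q)`, this is the component of type `(p + 1, q)` of `d α`,
so that `∂_I α = 0` means that `d α` is of type `(p, q + 1)`. -/
def del {n : ℕ} (I : EndField E M) (α : DForm E M ℂ n) : DForm E M ℂ (n + 1) :=
  fun x ↦ (1 / 2 : ℂ) • (dExt α x + Complex.I • dTwist I α x)

/-- The complex-valued form `α` is of type `(p, q)` with respect to `I`: a complex number `a + b i`
acting on all tangent vectors through `a + b I` multiplies `α` by `(a + b i)^p (a - b i)^q`. -/
def IsOfType {n : ℕ} (I : EndField E M) (p q : ℕ) (α : DForm E M ℂ n) : Prop :=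
  p + q = n ∧
    ∀ (x : M) (a b : ℝ) (v : Fin n → TangentSpace 𝓘(ℝ, E) x),
      α x (fun i ↦ a • v i + b • I x (v i)) =
        ((a : ℂ) + b * Complex.I) ^ p * ((a : ℂ) - b * Complex.I) ^ q * α x v

variable [IsManifold 𝓘(ℝ, E) ∞ M]

variable (E M) in
/-- Smooth Riemannian metrics on `M`. -/
abbrev Metric : Type _ :=
  ContMDiffRiemannianMetric 𝓘(ℝ, E) ∞ E (fun x : M ↦ TangentSpace 𝓘(ℝ, E) x)

/-- The form `Ω_I = I_{MN} dx^M ∧ dx^N`, where `I_{MN} u^M v^N = g(u, I v)`; thus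
`Ω_I(u, v) = g(u, I v) - g(v, I u)`, which is `2 g(u, I v)` if `g` is Hermitian. -/
def fundForm (g : Metric E M) (I : EndField E M) : DForm E M ℝ 2 := fun x ↦
  { toFun := fun v ↦ g.inner x (v 0) (I x (v 1)) - g.inner x (v 1) (I x (v 0))
    map_update_add' := by
      intro _ v i u w
      fin_cases i <;> simp <;> ring
    map_update_smul' := by
      intro _ v i c u
      fin_cases i <;> simp <;> ring
    cont := by
      have key : ∀ (G : E →L[ℝ] E →L[ℝ] ℝ) (A : E →L[ℝ] E),
          Continuous fun v : Fin 2 → E ↦ G (v 0) (A (v 1)) - G (v 1) (A (v 0)) := by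
        intro G A
        fun_prop
      exact key (g.inner x) (I x)
    map_eq_zero_of_eq' := by
      intro v i j hv hij
      have h01 : v 0 = v 1 := by
        fin_cases i <;> fin_cases j <;> simp_all
      simp [h01] }

/-- The complex-valued form `Ω_J + i Ω_K`. -/
def holForm (g : Metric E M) (J K : EndField E M) : DForm E M ℂ 2 := fun x ↦
  Complex.ofRealCLM.compContinuousAlternatingMap (fundForm g J x) +
    Complex.I • Complex.ofRealCLM.compContinuousAlternatingMap (fundForm g K x)

/-- A smooth integrable complex structure on `M`. Integrability is the vanishing of the Nijenhuis
tensor `[IX, IY] - I[IX, Y] - I[X, IY] - [X, Y]`. -/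
structure IsComplexStructure (I : EndField E M) : Prop where
  smooth : ContMDiff 𝓘(ℝ, E) (𝓘(ℝ, E).prod 𝓘(ℝ, E →L[ℝ] E)) ∞
    (fun x ↦ (TotalSpace.mk' (E →L[ℝ] E)
      (E := fun x : M ↦ TangentSpace 𝓘(ℝ, E) x →L[ℝ] TangentSpace 𝓘(ℝ, E) x) x (I x)))
  sq_eq_neg : ∀ (x : M) (v : TangentSpace 𝓘(ℝ, E) x), I x (I x v) = -v
  integrable : ∀ (x : M) (X Y : ∀ y : M, TangentSpace 𝓘(ℝ, E) y),
    MDiffAt (T% X) x → MDiffAt (T% Y) x →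
      VectorField.mlieBracket 𝓘(ℝ, E) (fun y ↦ I y (X y)) (fun y ↦ I y (Y y)) x
        - I x (VectorField.mlieBracket 𝓘(ℝ, E) (fun y ↦ I y (X y)) Y x)
        - I x (VectorField.mlieBracket 𝓘(ℝ, E) X (fun y ↦ I y (Y y)) x)
        - VectorField.mlieBracket 𝓘(ℝ, E) X Y x = 0

/-- A hypercomplex structure: three integrable complex structures satisfying the quaternion
algebra. -/
structure IsHypercomplex (I J K : EndField E M) : Prop where
  complex_I : IsComplexStructure I
  complex_J : IsComplexStructure J
  complex_K : IsComplexStructure K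
  mul_IJ : ∀ (x : M) (v : TangentSpace 𝓘(ℝ, E) x), I x (J x v) = K x v
  mul_JK : ∀ (x : M) (v : TangentSpace 𝓘(ℝ, E) x), J x (K x v) = I x v
  mul_KI : ∀ (x : M) (v : TangentSpace 𝓘(ℝ, E) x), K x (I x v) = J x v

/-- `g` is Hermitian with respect to `I`, that is, `I_{MN}` is antisymmetric when `I² = -1`. -/
def IsHermitian (g : Metric E M) (I : EndField E M) : Prop :=
  ∀ (x : M) (u v : TangentSpace 𝓘(ℝ, E) x), g.inner x (I x u) (I x v) = g.inner x u v

variable [FiniteDimensional ℝ E]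

variable (E M) in
/-- Affine connections on `M`. -/
abbrev Connection : Type _ :=
  CovariantDerivative 𝓘(ℝ, E) E (fun x : M ↦ TangentSpace 𝓘(ℝ, E) x)

/-- The torsion tensor with all indices lowered, `C(u, v, w) = g(u, T(v, w))`, where `T` is the
torsion of the connection. -/
def loweredTorsion (g : Metric E M) (cov : Connection E M) (x : M)
    (u v w : TangentSpace 𝓘(ℝ, E) x) : ℝ :=
  haveI : CompleteSpace E := FiniteDimensional.complete ℝ E
  g.inner x u (cov.torsion x v w)

/-- `cov` is the Bismut connection of the Hermitian structure `(g, I)`: it preserves `g` and `I`,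
and its torsion tensor with lowered indices is totally antisymmetric (antisymmetry in the last two
arguments holds for every connection). -/
structure IsBismutConnection (g : Metric E M) (I : EndField E M) (cov : Connection E M) :
    Prop where
  metric : ∀ (x : M) (Y Z : ∀ y : M, TangentSpace 𝓘(ℝ, E) y),
    MDiffAt (T% Y) x → MDiffAt (T% Z) x → ∀ u : TangentSpace 𝓘(ℝ, E) x,
      d% (fun y ↦ g.inner y (Y y) (Z y)) x u =
        g.inner x (cov Y x u) (Z x) + g.inner x (Y x) (cov Z x u)
  parallel : ∀ (x : M) (Y : ∀ y : M, TangentSpace 𝓘(ℝ, E) y), MDiffAt (T% Y) x →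
    ∀ u : TangentSpace 𝓘(ℝ, E) x, cov (fun y ↦ I y (Y y)) x u = I x (cov Y x u)
  skew : ∀ (x : M) (u v w : TangentSpace 𝓘(ℝ, E) x),
    loweredTorsion g cov x u v w = -loweredTorsion g cov x v u w

/-- `C` is the Bismut torsion `C_{MNK}(I)` of the Hermitian structure `(g, I)`. -/
def IsBismutTorsion (g : Metric E M) (I : EndField E M)
    (C : ∀ x : M, TangentSpace 𝓘(ℝ, E) x → TangentSpace 𝓘(ℝ, E) x → TangentSpace 𝓘(ℝ, E) x → ℝ) :
    Prop :=
  ∃ cov : Connection E M, IsBismutConnection g I cov ∧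
    ∀ (x : M) (u v w : TangentSpace 𝓘(ℝ, E) x), C x u v w = loweredTorsion g cov x u v w

/-- HKT structures: a hypercomplex structure together with a metric that is Hermitian for all three
complex structures, whose Bismut torsions coincide. -/
structure IsHKT (g : Metric E M) (I J K : EndField E M) : Prop where
  hypercomplex : IsHypercomplex I J K
  hermitian_I : IsHermitian g I
  hermitian_J : IsHermitian g J
  hermitian_K : IsHermitian g K
  same_torsion : ∃ C, IsBismutTorsion g I C ∧ IsBismutTorsion g J C ∧ IsBismutTorsion g K C

end Geometry

end HKT

end

open scoped Manifold ContDiff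
open Bundle

noncomputable section

namespace HKT

/-! ### Pointwise algebra of trilinear forms of mixed type. -/

section Trilinear

variable {V : Type*} [AddCommGroup V] [Module ℝ V]

/-! Write `C` for the common Bismut torsion and `ι_A` for the derivation induced by `A`. The
argument rests on two facts about one Bismut connection, followed by quaternionic linear algebra in
a single tangent space.

For `A` among `I, J, K`, the connection preserves `g` and `A` and has skew torsion, so
antisymmetrizing the derivatives of the coefficients of `Ω_A` gives `dΩ_A = 2 ι_A C`
(`dExt_fundForm_apply`). Integrability of `A` kills the `(3,0) + (0,3)` part of `C`
(`IsBismutConnection.isMixedType`). Because the three torsions coincide, the same `C` is of mixed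
type for all three structures.

In `ι_I ι_K C` the diagonal terms add up to `ι_J C`, since `KI = J`, and the mixed-type conditions
make the remaining six terms cancel (`offDiagonal_eq_zero`). Hence `ι_I dΩ_K = dΩ_J`, and cyclically
`ι_I dΩ_J = -dΩ_K`. Quaternion algebra alone gives `ι_I Ω_K = 2 Ω_J` and `ι_I Ω_J = -2 Ω_K`. So `d_I
Ω_K = 2 dΩ_J - dΩ_J = dΩ_J`, and likewise `d_I Ω_J = -dΩ_K`; these two identities give the vanishing
of `∂_I`. The type `(2,1)` follows from `Ω_J + iΩ_K` having a differential on which `ι_I` acts as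
`i`.

Bracket terms never appear in the formula for `d`, because derivatives are computed on vector fields
that are constant in the preferred chart. -/

/-- `C` is linear in each of its three arguments. -/
structure IsTrilinear (C : V → V → V → ℝ) : Prop where
  left : ∀ (a b : ℝ) (u u' v w : V), C (a • u + b • u') v w = a * C u v w + b * C u' v w
  middle : ∀ (a b : ℝ) (u v v' w : V), C u (a • v + b • v') w = a * C u v w + b * C u v' w
  right : ∀ (a b : ℝ) (u v w w' : V), C u v (a • w + b • w') = a * C u v w + b * C u v w'

namespace IsTrilinear

variable {C : V → V → V → ℝ}

lemma neg_left (hC : IsTrilinear C) (u v w : V) : C (-u) v w = -C u v w := by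
  simpa using hC.left (-1) 0 u 0 v w

lemma neg_middle (hC : IsTrilinear C) (u v w : V) : C u (-v) w = -C u v w := by
  simpa using hC.middle (-1) 0 u v 0 w

lemma neg_right (hC : IsTrilinear C) (u v w : V) : C u v (-w) = -C u v w := by
  simpa using hC.right (-1) 0 u v w 0

lemma const_mul (hC : IsTrilinear C) (c : ℝ) : IsTrilinear (fun u v w ↦ c * C u v w) where
  left a b u u' v w := by simp only [hC.left]; ring
  middle a b u v v' w := by simp only [hC.middle]; ring
  right a b u v w w' := by simp only [hC.right]; ring

end IsTrilinear

variable [TopologicalSpace V]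

/-- `C` is of type `(2,1) + (1,2)` with respect to the complex structure `A`. -/
def IsMixedType (A : V →L[ℝ] V) (C : V → V → V → ℝ) : Prop :=
  ∀ u v w, C u v w = C (A u) (A v) w + C (A u) v (A w) + C u (A v) (A w)

/-- The action of `A` as a derivation on functions of three arguments. -/
def triIota (A : V →L[ℝ] V) (C : V → V → V → ℝ) (u v w : V) : ℝ :=
  C (A u) v w + C u (A v) w + C u v (A w)

namespace IsTrilinear

variable {C : V → V → V → ℝ}

lemma triIota (hC : IsTrilinear C) (A : V →L[ℝ] V) : IsTrilinear (triIota A C) where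
  left a b u u' v w := by
    simp only [HKT.triIota, map_add, map_smul, hC.left]; ring
  middle a b u v v' w := by
    simp only [HKT.triIota, map_add, map_smul, hC.middle]; ring
  right a b u v w w' := by
    simp only [HKT.triIota, map_add, map_smul, hC.right]; ring

/-- Let `S = C(Ju,v,w) + C(u,Jv,w) + C(u,v,Jw)`. Mixed type for `J` gives `S = -2S + 3 C(Ju,Jv,Jw)`,
so `S = C(Ju,Jv,Jw)`. Mixed type for `I` at `(Ju,Jv,Jw)` turns this into the sum of the terms with
one `J` and two `K`'s. Mixed type for `K` says that `S` is that same sum minus the expression in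
question. No symmetry of `C` is needed. -/
lemma offDiagonal_eq_zero (hC : IsTrilinear C) {I J K : V →L[ℝ] V}
    (hJJ : ∀ v, J (J v) = -v) (hKJ : ∀ v, K (J v) = -I v) (hIJ : ∀ v, I (J v) = K v)
    (hI : IsMixedType I C) (hJ : IsMixedType J C) (hK : IsMixedType K C) (u v w : V) :
    C (I u) (K v) w + C (K u) (I v) w + C (I u) v (K w) + C (K u) v (I w)
      + C u (I v) (K w) + C u (K v) (I w) = 0 := by
  have a1 := hK (J u) v w
  have a2 := hK u (J v) w
  have a3 := hK u v (J w)
  have b1 := hJ (J u) v w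
  have b2 := hJ u (J v) w
  have b3 := hJ u v (J w)
  have c := hI (J u) (J v) (J w)
  simp only [hJJ, hKJ, hIJ, hC.neg_left, hC.neg_middle, hC.neg_right] at a1 a2 a3 b1 b2 b3 c
  linarith

/-- If `C` is of type `(2,1) + (1,2)` with respect to the three complex structures, then the
derivations they induce satisfy the relation `I K = J` on `C`. -/
lemma triIota_triIota (hC : IsTrilinear C) {I J K : V →L[ℝ] V}
    (hJJ : ∀ v, J (J v) = -v) (hKJ : ∀ v, K (J v) = -I v) (hIJ : ∀ v, I (J v) = K v)
    (hKI : ∀ v, K (I v) = J v)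
    (hI : IsMixedType I C) (hJ : IsMixedType J C) (hK : IsMixedType K C) (u v w : V) :
    HKT.triIota I (HKT.triIota K C) u v w = HKT.triIota J C u v w := by
  have h := hC.offDiagonal_eq_zero hJJ hKJ hIJ hI hJ hK u v w
  simp only [HKT.triIota, hKI]
  linarith

/-- If `C` is of type `(2,1) + (1,2)` with respect to the three complex structures, then the
derivations they induce satisfy the relation `I J = -K` on `C`. -/
lemma triIota_triIota_neg (hC : IsTrilinear C) {I J K : V →L[ℝ] V}
    (hKK : ∀ v, K (K v) = -v) (hIK : ∀ v, I (K v) = -J v) (hJK : ∀ v, J (K v) = I v)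
    (hJI : ∀ v, J (I v) = -K v)
    (hI : IsMixedType I C) (hJ : IsMixedType J C) (hK : IsMixedType K C) (u v w : V) :
    HKT.triIota I (HKT.triIota J C) u v w = -HKT.triIota K C u v w := by
  -- The cyclic rotation `(I, J, K) → (J, K, I)` of the cancellation.
  have h := hC.offDiagonal_eq_zero hKK hIK hJK hJ hK hI u v w
  simp only [HKT.triIota, hJI, hC.neg_left, hC.neg_middle, hC.neg_right]
  linarith

/-- If `C + i s` is an eigenvector of the derivation induced by `I` with eigenvalue `i`, then it is of type
`(2,1)`; this is the real part. -/
lemma apply_complexMul (ht : IsTrilinear C) {s : V → V → V → ℝ} {I : V →L[ℝ] V}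
    (hII : ∀ v, I (I v) = -v) (hts : ∀ u v w, HKT.triIota I C u v w = -s u v w)
    (hst : ∀ u v w, HKT.triIota I s u v w = C u v w) (a b : ℝ) (u v w : V) :
    C (a • u + b • I u) (a • v + b • I v) (a • w + b • I w) =
      (a ^ 2 + b ^ 2) * (a * C u v w - b * s u v w) := by
  -- Here `ι² C = -C`, while expanding with `I² = -1` gives `ι² C = -3C` plus twice the sum of the
  -- terms with two `I`'s; so that sum is `C`.
  have hmix : IsMixedType I C := by
    intro u v w
    have h := hst u v w
    have h1 := hts (I u) v w
    have h2 := hts u (I v) w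
    have h3 := hts u v (I w)
    simp only [HKT.triIota, hII, ht.neg_left, ht.neg_middle, ht.neg_right] at h h1 h2 h3
    linarith
  have h1 := hts u v w
  have h2 := hmix u v w
  have h3 := hmix (I u) v w
  simp only [HKT.triIota, hII, ht.neg_left] at h1 h2 h3
  simp only [ht.left, ht.middle, ht.right]
  -- In the expansion in `a` and `b`, the terms with one `I` sum to `-s`, those with two sum to `C`,
  -- and the term with three is again `-s`.
  linear_combination (a ^ 2 * b + b ^ 3) * h1 - a * b ^ 2 * h2 - b ^ 3 * h3

end IsTrilinear

end Trilinear

/-! ### Differentiability of families of alternating forms. -/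

section AlternatingMaps

variable {E : Type*} [NormedAddCommGroup E] [NormedSpace ℝ E] [FiniteDimensional ℝ E]
  {X : Type*} [NormedAddCommGroup X] [NormedSpace ℝ X]

/-- In finite dimension, a family of alternating forms is differentiable if all its values are. -/
lemma differentiableAt_of_forall_apply {n : ℕ} {η : X → E [⋀^Fin n]→L[ℝ] ℝ} {x : X}
    (h : ∀ v : Fin n → E, DifferentiableAt ℝ (fun y ↦ η y v) x) : DifferentiableAt ℝ η x := by
  let b := Module.finBasis ℝ E
  let Φ : (E [⋀^Fin n]→L[ℝ] ℝ) →ₗ[ℝ] ((Fin n → Fin (Module.finrank ℝ E)) → ℝ) :=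
    { toFun := fun α s ↦ α (fun i ↦ b (s i))
      map_add' := fun _ _ ↦ rfl
      map_smul' := fun _ _ ↦ rfl }
  -- An alternating form is determined by its values on tuples of basis vectors, so a linear left
  -- inverse of `Φ` recovers the family from finitely many scalar functions.
  have hΦ : Function.Injective Φ := by
    intro α β hαβ
    apply ContinuousAlternatingMap.toAlternatingMap_injective
    apply AlternatingMap.coe_multilinearMap_injective
    exact Module.Basis.ext_multilinear (fun _ ↦ b) fun s ↦ congrFun hαβ s
  have : FiniteDimensional ℝ (E [⋀^Fin n]→L[ℝ] ℝ) := FiniteDimensional.of_injective Φ hΦ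
  obtain ⟨Ψ, hΨ⟩ := Φ.exists_leftInverse_of_injective (LinearMap.ker_eq_bot.2 hΦ)
  have hη : η = fun y ↦ Ψ.toContinuousLinearMap (Φ (η y)) := by
    funext y
    exact (LinearMap.congr_fun hΨ (η y)).symm
  rw [hη]
  refine Ψ.toContinuousLinearMap.differentiableAt.comp x ?_
  rw [differentiableAt_pi]
  exact fun s ↦ h _

end AlternatingMaps

/-! ### Coordinate vector fields. -/

section CoordField

variable {E : Type*} [NormedAddCommGroup E] [NormedSpace ℝ E]
  {M : Type*} [TopologicalSpace M] [ChartedSpace E M]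

/-- The constant vector field on the model space. -/
def constField (v : E) : ∀ y : E, TangentSpace 𝓘(ℝ, E) y := fun _ ↦ v

/-- The vector field which is constant, equal to `v`, in the preferred chart at `x`. -/
def coordField (x : M) (v : TangentSpace 𝓘(ℝ, E) x) : ∀ y : M, TangentSpace 𝓘(ℝ, E) y :=
  VectorField.mpullback 𝓘(ℝ, E) 𝓘(ℝ, E) (extChartAt 𝓘(ℝ, E) x) (constField (E := E) v)

lemma contMDiff_constField (v : E) :
    ContMDiff 𝓘(ℝ, E) 𝓘(ℝ, E).tangent 1 (T% (constField v)) := fun _ ↦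
  contMDiffAt_vectorSpace_iff_contDiffAt.2 (contDiffAt_const (c := v))

lemma mlieBracket_constField (v w : E) :
    VectorField.mlieBracket 𝓘(ℝ, E) (constField v) (constField w) = 0 := by
  rw [← VectorField.mlieBracketWithin_univ, VectorField.mlieBracketWithin_eq_lieBracketWithin]
  funext y
  change VectorField.lieBracketWithin ℝ (fun _ : E ↦ v) (fun _ : E ↦ w) Set.univ y = 0
  simp [VectorField.lieBracketWithin]

variable [IsManifold 𝓘(ℝ, E) ∞ M]

lemma coordField_self (x : M) (v : TangentSpace 𝓘(ℝ, E) x) : coordField x v x = v := by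
  have h := mfderiv_extChartAt_self (I := 𝓘(ℝ, E)) (x := x)
  unfold coordField
  rw [VectorField.mpullback_apply, h]
  exact congrArg (fun L : E →L[ℝ] E ↦ L v) ContinuousLinearMap.inverse_id

/-- The pullback inverts the derivative of the chart, and on the target that inverse is the
derivative of the inverse chart. This identifies the chart expression of a form with its
coefficients on coordinate fields. -/
lemma coordField_symm (x : M) (v : TangentSpace 𝓘(ℝ, E) x) {y : E}
    (hy : y ∈ (extChartAt 𝓘(ℝ, E) x).target) :
    coordField x v ((extChartAt 𝓘(ℝ, E) x).symm y) =
      mfderiv 𝓘(ℝ, E) 𝓘(ℝ, E) (extChartAt 𝓘(ℝ, E) x).symm y v := by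
  have h1 := mfderivWithin_extChartAt_symm_comp_mfderiv_extChartAt hy
  have h2 := mfderiv_extChartAt_comp_mfderivWithin_extChartAt_symm hy
  have h : (mfderiv 𝓘(ℝ, E) 𝓘(ℝ, E) (extChartAt 𝓘(ℝ, E) x)
      ((extChartAt 𝓘(ℝ, E) x).symm y)).inverse = _ := ContinuousLinearMap.inverse_eq h2 h1
  simp only [modelWithCornersSelf_coe, Set.range_id, mfderivWithin_univ] at h
  exact congrArg (fun L : E →L[ℝ] E ↦ L v) h

lemma mdifferentiableAt_coordField [CompleteSpace E] (x : M) (v : TangentSpace 𝓘(ℝ, E) x) :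
    MDiffAt (T% (coordField x v)) x := by
  have h := ContMDiffAt.mpullback_vectorField_preimage (I := 𝓘(ℝ, E)) (I' := 𝓘(ℝ, E))
    (n := 2) (m := 1) (f := extChartAt 𝓘(ℝ, E) x) (x₀ := x)
    (contMDiff_constField (E := E) v _) contMDiffAt_extChartAt
    (isInvertible_mfderiv_extChartAt (mem_extChartAt_source x)) (by norm_num)
  exact h.mdifferentiableAt one_ne_zero

/-- The bracket is natural under pullback by the chart, and constant fields on `E` commute. -/
lemma mlieBracket_coordField [CompleteSpace E] (x : M) (v w : TangentSpace 𝓘(ℝ, E) x) :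
    VectorField.mlieBracket 𝓘(ℝ, E) (coordField x v) (coordField x w) x = 0 := by
  have : IsManifold 𝓘(ℝ, E) (minSmoothness ℝ 2) M := by
    rw [minSmoothness_of_isRCLikeNormedField]; infer_instance
  have h := VectorField.mpullback_mlieBracket (I := 𝓘(ℝ, E)) (I' := 𝓘(ℝ, E)) (n := 2)
    (f := extChartAt 𝓘(ℝ, E) x) (x₀ := x)
    ((contMDiff_constField (E := E) v _).mdifferentiableAt one_ne_zero)
    ((contMDiff_constField (E := E) w _).mdifferentiableAt one_ne_zero)
    contMDiffAt_extChartAt (by simp)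
  refine h.symm.trans ?_
  refine (congrArg (fun V ↦ VectorField.mpullback 𝓘(ℝ, E) 𝓘(ℝ, E) (extChartAt 𝓘(ℝ, E) x) V x)
    (mlieBracket_constField (E := E) v w)).trans ?_
  exact map_zero (mfderiv 𝓘(ℝ, E) 𝓘(ℝ, E) (extChartAt 𝓘(ℝ, E) x) x).inverse

end CoordField

/-! ### The exterior derivative in terms of chart coefficients. -/

section ExteriorDerivative

variable {E : Type*} [NormedAddCommGroup E] [NormedSpace ℝ E]
  {M : Type*} [TopologicalSpace M] [ChartedSpace E M]

lemma dExt_smul {n : ℕ} (c : ℝ) (α : DForm E M ℝ n) :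
    dExt (fun x ↦ c • α x) = fun x ↦ c • dExt α x := by
  funext x
  have h : (DForm.inChart (fun x ↦ c • α x) x) = c • α.inChart x := rfl
  unfold dExt
  rw [h, extDeriv_smul]
  rfl

/-- The complex-valued form `α + i β`. -/
def complexForm {n : ℕ} (α β : DForm E M ℝ n) : DForm E M ℂ n := fun x ↦
  Complex.ofRealCLM.compContinuousAlternatingMap (α x) +
    Complex.I • Complex.ofRealCLM.compContinuousAlternatingMap (β x)

lemma complexForm_apply {n : ℕ} (α β : DForm E M ℝ n) (x : M)
    (v : Fin n → TangentSpace 𝓘(ℝ, E) x) :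
    complexForm α β x v = (α x v : ℂ) + Complex.I * (β x v : ℂ) := rfl

variable [IsManifold 𝓘(ℝ, E) ∞ M]

/-- The coefficients of a differential form in the preferred chart at `x`. -/
def DForm.coeff {n : ℕ} (α : DForm E M ℝ n) (x : M) (v : Fin n → TangentSpace 𝓘(ℝ, E) x) (y : M) : ℝ :=
  α y (fun i ↦ coordField x (v i) y)

/-- The coefficients of `α` in the preferred chart at `x` are differentiable at `x`. -/
def DForm.HasMDiffCoeff {n : ℕ} (α : DForm E M ℝ n) : Prop :=
  ∀ (x : M) (v : Fin n → TangentSpace 𝓘(ℝ, E) x), MDiffAt (α.coeff x v) x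

lemma DForm.inChart_eventuallyEq {n : ℕ} (α : DForm E M ℝ n) (x : M) (v : Fin n → TangentSpace 𝓘(ℝ, E) x) :
    (fun y ↦ α.inChart x y v) =ᶠ[nhds (extChartAt 𝓘(ℝ, E) x x)]
      α.coeff x v ∘ (extChartAt 𝓘(ℝ, E) x).symm := by
  filter_upwards [extChartAt_target_mem_nhds (I := 𝓘(ℝ, E)) x] with y hy
  change α ((extChartAt 𝓘(ℝ, E) x).symm y) (fun i ↦
    mfderiv 𝓘(ℝ, E) 𝓘(ℝ, E) (extChartAt 𝓘(ℝ, E) x).symm y (v i)) = _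
  exact congrArg (α ((extChartAt 𝓘(ℝ, E) x).symm y))
    (funext fun i ↦ (coordField_symm x (v i) hy).symm)

lemma DForm.HasMDiffCoeff.inChart_apply {n : ℕ} {α : DForm E M ℝ n} (h : α.HasMDiffCoeff)
    (x : M) (v : Fin n → TangentSpace 𝓘(ℝ, E) x) :
    DifferentiableAt ℝ (fun y ↦ α.inChart x y v) (extChartAt 𝓘(ℝ, E) x x) := by
  have := (h x v).differentiableWithinAt_writtenInExtChartAt
  simp only [writtenInExtChartAt, modelWithCornersSelf_coe, Set.range_id,
    differentiableWithinAt_univ, extChartAt_model_space_eq_id] at this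
  exact this.congr_of_eventuallyEq (α.inChart_eventuallyEq x v)

variable [FiniteDimensional ℝ E]

lemma DForm.HasMDiffCoeff.inChart {n : ℕ} {α : DForm E M ℝ n} (h : α.HasMDiffCoeff) (x : M) :
    DifferentiableAt ℝ (α.inChart x) (extChartAt 𝓘(ℝ, E) x x) :=
  differentiableAt_of_forall_apply (h.inChart_apply x)

/-- The invariant formula for `d` without its bracket terms, since coordinate fields commute. The
chart has identity derivative at its base point, so no change of frame appears. -/
lemma dExt_apply {n : ℕ} {α : DForm E M ℝ n} (h : α.HasMDiffCoeff) (x : M)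
    (v : Fin (n + 1) → TangentSpace 𝓘(ℝ, E) x) :
    dExt α x v = ∑ i : Fin (n + 1), (-1) ^ i.val •
      d% (α.coeff x (i.removeNth v)) x (v i) := by
  have h1 : dExt α x v = extDeriv (α.inChart x) (extChartAt 𝓘(ℝ, E) x x) v := by
    have h0 := mfderiv_extChartAt_self (I := 𝓘(ℝ, E)) (x := x)
    unfold dExt
    rw [h0]
    rfl
  rw [h1]
  refine (extDeriv_apply (h.inChart x) v).trans (Finset.sum_congr rfl fun i _ ↦ ?_)
  congr 1
  have h2 := (α.inChart_eventuallyEq x (i.removeNth v)).fderiv_eq (𝕜 := ℝ)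
  refine (congrArg (fun L : E →L[ℝ] ℝ ↦ L (v i : E)) h2).trans ?_
  have h3 := (h x (i.removeNth v)).mfderiv
  simp only [writtenInExtChartAt, modelWithCornersSelf_coe, Set.range_id,
    fderivWithin_univ, extChartAt_model_space_eq_id] at h3
  exact (congrArg (fun L : E →L[ℝ] ℝ ↦ L (v i : E)) h3).symm

/-- Differentiability of both parts is what allows the derivative to split over the sum; it then
commutes with the two constant maps `r ↦ r` and `r ↦ i r` from `ℝ` to `ℂ`. -/
lemma dExt_complexForm {n : ℕ} {α β : DForm E M ℝ n} (hα : α.HasMDiffCoeff)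
    (hβ : β.HasMDiffCoeff) :
    dExt (complexForm α β) = complexForm (dExt α) (dExt β) := by
  funext x
  let L : (E [⋀^Fin n]→L[ℝ] ℝ) →L[ℝ] (E [⋀^Fin n]→L[ℝ] ℂ) :=
    Complex.ofRealCLM.compContinuousAlternatingMapCLM ℝ E ℝ ℂ (Fin n)
  let L' : (E [⋀^Fin n]→L[ℝ] ℝ) →L[ℝ] (E [⋀^Fin n]→L[ℝ] ℂ) :=
    (Complex.I • Complex.ofRealCLM).compContinuousAlternatingMapCLM ℝ E ℝ ℂ (Fin n)
  have h : (complexForm α β).inChart x = fun y ↦ L (α.inChart x y) + L' (β.inChart x y) := rfl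
  have hd : fderiv ℝ ((complexForm α β).inChart x) (extChartAt 𝓘(ℝ, E) x x) =
      L ∘L fderiv ℝ (α.inChart x) (extChartAt 𝓘(ℝ, E) x x) +
        L' ∘L fderiv ℝ (β.inChart x) (extChartAt 𝓘(ℝ, E) x x) := by
    rw [h]
    exact ((L.hasFDerivAt.comp _ (hα.inChart x).hasFDerivAt).add
      (L'.hasFDerivAt.comp _ (hβ.inChart x).hasFDerivAt)).fderiv
  have he : extDeriv ((complexForm α β).inChart x) (extChartAt 𝓘(ℝ, E) x x) =
      Complex.ofRealCLM.compContinuousAlternatingMap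
          (extDeriv (α.inChart x) (extChartAt 𝓘(ℝ, E) x x)) +
        (Complex.I • Complex.ofRealCLM).compContinuousAlternatingMap
          (extDeriv (β.inChart x) (extChartAt 𝓘(ℝ, E) x x)) := by
    ext v
    simp only [extDeriv, hd, ContinuousAlternatingMap.alternatizeUncurryFin_apply]
    change _ = ((ContinuousAlternatingMap.alternatizeUncurryFin
        (fderiv ℝ (α.inChart x) (extChartAt 𝓘(ℝ, E) x x)) v : ℝ) : ℂ) +
      Complex.I * ((ContinuousAlternatingMap.alternatizeUncurryFin
        (fderiv ℝ (β.inChart x) (extChartAt 𝓘(ℝ, E) x x)) v : ℝ) : ℂ)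
    simp only [ContinuousAlternatingMap.alternatizeUncurryFin_apply, Complex.ofReal_sum,
      Finset.mul_sum, ← Finset.sum_add_distrib]
    refine Finset.sum_congr rfl fun i _ ↦ ?_
    have happ : ∀ (a b : E →L[ℝ] E [⋀^Fin n]→L[ℝ] ℝ) (u : E) (w : Fin n → E),
        (L ∘L a + L' ∘L b) u w = (a u w : ℂ) + Complex.I * (b u w : ℂ) := fun _ _ _ _ ↦ rfl
    rw [happ]
    simp only [zsmul_eq_mul]
    push_cast
    ring
  unfold dExt
  rw [he]
  rfl

end ExteriorDerivative

/-! ### Bismut torsion and the differential of the fundamental form. -/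

section Hermitian

variable {E : Type*} [NormedAddCommGroup E] [NormedSpace ℝ E]
  {M : Type*} [TopologicalSpace M] [ChartedSpace E M] [IsManifold 𝓘(ℝ, E) ∞ M]
  {g : Metric E M} {A : EndField E M}

lemma Metric.mdifferentiableAt_inner (g : Metric E M) {x : M}
    {X Y : ∀ y : M, TangentSpace 𝓘(ℝ, E) y}
    (hX : MDiffAt (T% X) x) (hY : MDiffAt (T% Y) x) :
    MDiffAt (fun y ↦ g.inner y (X y) (Y y)) x := by
  have : MDifferentiableAt 𝓘(ℝ, E) (𝓘(ℝ, E).prod 𝓘(ℝ))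
      (fun y ↦ TotalSpace.mk' ℝ (E := Bundle.Trivial M ℝ) y (g.inner y (X y) (Y y))) x :=
    MDifferentiableAt.clm_bundle_apply₂ (F₁ := E) (F₂ := E)
      (g.contMDiff.mdifferentiableAt (by simp)) hX hY
  rw [mdifferentiableAt_totalSpace] at this
  exact this.2

lemma IsComplexStructure.mdifferentiableAt_apply (hA : IsComplexStructure A) {x : M}
    {X : ∀ y : M, TangentSpace 𝓘(ℝ, E) y} (hX : MDiffAt (T% X) x) :
    MDiffAt (T% (fun y ↦ A y (X y))) x :=
  MDifferentiableAt.clm_bundle_apply (F₁ := E) (F₂ := E)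
    (hA.smooth.mdifferentiableAt (by simp)) hX

lemma IsHermitian.inner_apply_right (hg : IsHermitian g A) (hA : IsComplexStructure A) (x : M)
    (u v : TangentSpace 𝓘(ℝ, E) x) : g.inner x u (A x v) = -g.inner x (A x u) v := by
  rw [← hg x u, hA.sq_eq_neg, map_neg]

lemma fundForm_apply (hg : IsHermitian g A) (hA : IsComplexStructure A) (x : M)
    (v : Fin 2 → TangentSpace 𝓘(ℝ, E) x) :
    fundForm g A x v = 2 * g.inner x (v 0) (A x (v 1)) := by
  change g.inner x (v 0) (A x (v 1)) - g.inner x (v 1) (A x (v 0)) = _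
  rw [hg.inner_apply_right hA x (v 1), g.symm x (A x (v 1))]
  ring

lemma fundForm_coeff (hg : IsHermitian g A) (hA : IsComplexStructure A) (x : M) (v : Fin 2 → TangentSpace 𝓘(ℝ, E) x) :
    (fundForm g A).coeff x v =
      (2 : ℝ) • fun y ↦ g.inner y (coordField x (v 0) y) (A y (coordField x (v 1) y)) := by
  funext y
  simpa using! fundForm_apply hg hA y (fun i ↦ coordField x (v i) y)

lemma fundForm_hasMDiffCoeff [CompleteSpace E] (hg : IsHermitian g A)
    (hA : IsComplexStructure A) : (fundForm g A).HasMDiffCoeff := by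
  intro x v
  rw [fundForm_coeff hg hA]
  exact (g.mdifferentiableAt_inner (mdifferentiableAt_coordField x (v 0))
    (hA.mdifferentiableAt_apply (mdifferentiableAt_coordField x (v 1)))).const_smul 2

variable [FiniteDimensional ℝ E] {cov : Connection E M}

lemma loweredTorsion_antisymm (g : Metric E M) (cov : Connection E M) (x : M)
    (u v w : TangentSpace 𝓘(ℝ, E) x) :
    loweredTorsion g cov x u v w = -loweredTorsion g cov x u w v := by
  have : CompleteSpace E := FiniteDimensional.complete ℝ E
  unfold loweredTorsion
  rw [cov.torsion_antisymm, map_neg]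

lemma isTrilinear_loweredTorsion (g : Metric E M) (cov : Connection E M) (x : M) :
    IsTrilinear (loweredTorsion g cov x) where
  left a b u u' v w := by simp [loweredTorsion]
  middle a b u v v' w := by simp [loweredTorsion]
  right a b u v w w' := by simp [loweredTorsion]

/-- The torsion of `cov` evaluated on coordinate vector fields. -/
lemma loweredTorsion_coordField (g : Metric E M) (cov : Connection E M) (x : M)
    (u v w : TangentSpace 𝓘(ℝ, E) x) :
    loweredTorsion g cov x u v w =
      g.inner x u (cov (coordField x w) x v) - g.inner x u (cov (coordField x v) x w) := by
  have : CompleteSpace E := FiniteDimensional.complete ℝ E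
  have h := cov.torsion_apply (mdifferentiableAt_coordField x v)
    (mdifferentiableAt_coordField x w)
  rw [mlieBracket_coordField, sub_zero, coordField_self, coordField_self] at h
  unfold loweredTorsion
  rw [h, map_sub]

/-- The Bismut torsion of a complex structure is of type `(2,1) + (1,2)`. -/
lemma IsBismutConnection.isMixedType (hc : IsBismutConnection g A cov) (hg : IsHermitian g A)
    (hA : IsComplexStructure A) (x : M) : IsMixedType (A x) (loweredTorsion g cov x) := by
  have : CompleteSpace E := FiniteDimensional.complete ℝ E
  intro u v w
  have hX := mdifferentiableAt_coordField x v
  have hY := mdifferentiableAt_coordField x w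
  have hAX := hA.mdifferentiableAt_apply hX
  have hAY := hA.mdifferentiableAt_apply hY
  have t1 := cov.torsion_apply hX hY
  have t2 := cov.torsion_apply hAX hY
  have t3 := cov.torsion_apply hX hAY
  have t4 := cov.torsion_apply hAX hAY
  have hN := hA.integrable x _ _ hX hY
  simp only [hc.parallel x _ hX, hc.parallel x _ hY] at t2 t3 t4
  simp only [coordField_self] at t1 t2 t3 t4
  -- Since `A` is parallel, all covariant derivatives cancel in the difference of the two sides,
  -- leaving only the Nijenhuis tensor.
  have hT : cov.torsion x v w = cov.torsion x (A x v) (A x w)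
      - A x (cov.torsion x (A x v) w) - A x (cov.torsion x v (A x w)) := by
    rw [t1, t2, t3, t4]
    simp only [map_sub, hA.sq_eq_neg]
    rw [← sub_eq_zero, ← hN]
    abel
  unfold loweredTorsion
  rw [hT]
  simp only [map_sub, hg.inner_apply_right hA]
  ring

/-- Metric compatibility differentiates `2 g(X, AY)`; parallelism moves `A` out of the covariant
derivative, and `A` is skew for `g`. -/
lemma IsBismutConnection.mvfderiv_fundForm_coeff (hc : IsBismutConnection g A cov)
    (hg : IsHermitian g A) (hA : IsComplexStructure A) (x : M) (u v w : TangentSpace 𝓘(ℝ, E) x) :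
    d% ((fundForm g A).coeff x ![v, w]) x u =
      2 * (g.inner x (A x w) (cov (coordField x v) x u) -
        g.inner x (A x v) (cov (coordField x w) x u)) := by
  have : CompleteSpace E := FiniteDimensional.complete ℝ E
  have hX := mdifferentiableAt_coordField x v
  have hY := mdifferentiableAt_coordField x w
  have hAY := hA.mdifferentiableAt_apply hY
  have hf := g.mdifferentiableAt_inner hX hAY
  have h := hc.metric x _ _ hX hAY u
  rw [hc.parallel x _ hY, coordField_self, coordField_self, hg.inner_apply_right hA x v] at h
  rw [fundForm_coeff hg hA, two_smul]
  refine (congrArg (fun L : TangentSpace 𝓘(ℝ, E) x →L[ℝ] ℝ ↦ L u) (mvfderiv_add hf hf)).trans ?_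
  change d% (fun y ↦ g.inner y (coordField x v y) (A y (coordField x w y))) x u +
    d% (fun y ↦ g.inner y (coordField x v y) (A y (coordField x w y))) x u = _
  rw [h, g.symm x (cov (coordField x v) x u)]
  ring

/-- The six covariant derivatives in the alternating sum pair up into three torsions, each tested
against some `A (v i)`. -/
lemma IsBismutConnection.dExt_fundForm_apply (hc : IsBismutConnection g A cov)
    (hg : IsHermitian g A) (hA : IsComplexStructure A) (x : M)
    (v : Fin 3 → TangentSpace 𝓘(ℝ, E) x) :
    dExt (fundForm g A) x v =
      2 * (loweredTorsion g cov x (A x (v 0)) (v 1) (v 2) +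
        loweredTorsion g cov x (v 0) (A x (v 1)) (v 2) +
        loweredTorsion g cov x (v 0) (v 1) (A x (v 2))) := by
  have : CompleteSpace E := FiniteDimensional.complete ℝ E
  have e0 : (0 : Fin 3).removeNth v = ![v 1, v 2] := by ext i; fin_cases i <;> rfl
  have e1 : (1 : Fin 3).removeNth v = ![v 0, v 2] := by ext i; fin_cases i <;> rfl
  have e2 : (2 : Fin 3).removeNth v = ![v 0, v 1] := by ext i; fin_cases i <;> rfl
  -- Skewness brings each `A (v i)` to the first slot, so that the torsion itself is evaluated only
  -- on the original vectors and their coordinate fields.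
  rw [dExt_apply (fundForm_hasMDiffCoeff hg hA), Fin.sum_univ_three, e0, e1, e2,
    hc.mvfderiv_fundForm_coeff hg hA, hc.mvfderiv_fundForm_coeff hg hA,
    hc.mvfderiv_fundForm_coeff hg hA, hc.skew x (v 0) (A x (v 1)),
    loweredTorsion_antisymm g cov x (v 0) (v 1) (A x (v 2)), hc.skew x (v 0) (A x (v 2))]
  simp only [loweredTorsion_coordField]
  norm_num
  ring
end Hermitian

/-! ### The derivation `ι` on forms. -/

section Iota

variable {V : Type*} [AddCommGroup V] [Module ℝ V] [TopologicalSpace V]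
  {F : Type*} [NormedAddCommGroup F] [NormedSpace ℝ F]

lemma iotaAt_apply {n : ℕ} (A : V →L[ℝ] V) (α : V [⋀^Fin n]→L[ℝ] F) (v : Fin n → V) :
    iotaAt A α v = ∑ k, α (Function.update v k (A (v k))) := by
  change (∑ k : Fin n, α.toContinuousMultilinearMap.compContinuousLinearMap
      (Function.update (fun _ ↦ ContinuousLinearMap.id ℝ V) k A)) v = _
  rw [_root_.sum_apply]
  refine Finset.sum_congr rfl fun k _ ↦ ?_
  rw [ContinuousMultilinearMap.compContinuousLinearMap_apply]
  refine congrArg α (funext fun l ↦ ?_)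
  by_cases h : l = k
  · subst h; simp
  · simp [h]

lemma iotaAt_apply_three {A : V →L[ℝ] V} {α : V [⋀^Fin 3]→L[ℝ] ℝ} {t : V → V → V → ℝ}
    (h : ∀ v : Fin 3 → V, α v = t (v 0) (v 1) (v 2)) (v : Fin 3 → V) :
    iotaAt A α v = triIota A t (v 0) (v 1) (v 2) := by
  rw [iotaAt_apply, Fin.sum_univ_three]
  simp [h, triIota]

end Iota

/-! ### Splitting complex-valued forms into real and imaginary parts. -/

section ComplexForms

variable {E : Type*} [NormedAddCommGroup E] [NormedSpace ℝ E]
  {M : Type*} [TopologicalSpace M] [ChartedSpace E M]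

lemma iota_complexForm {n : ℕ} (I : EndField E M) (α β : DForm E M ℝ n) :
    iota I (complexForm α β) = complexForm (iota I α) (iota I β) := by
  funext x
  ext v
  simp only [iota, complexForm_apply, iotaAt_apply, Complex.ofReal_sum, Finset.mul_sum,
    Finset.sum_add_distrib]

lemma complexForm_sub {n : ℕ} (α α' β β' : DForm E M ℝ n) (x : M) :
    complexForm α β x - complexForm α' β' x =
      complexForm (fun y ↦ α y - α' y) (fun y ↦ β y - β' y) x := by
  ext v
  change complexForm α β x v - complexForm α' β' x v = _
  simp only [complexForm_apply, ContinuousAlternatingMap.sub_apply, Complex.ofReal_sub]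
  ring

lemma DForm.HasMDiffCoeff.const_smul {n : ℕ} {α : DForm E M ℝ n} (h : α.HasMDiffCoeff) (c : ℝ) :
    DForm.HasMDiffCoeff (fun x ↦ c • α x) := fun x v ↦ (h x v).const_smul c

variable [IsManifold 𝓘(ℝ, E) ∞ M] [FiniteDimensional ℝ E]

lemma dTwist_complexForm {n : ℕ} (I : EndField E M) {α β : DForm E M ℝ n}
    (hα : α.HasMDiffCoeff) (hβ : β.HasMDiffCoeff)
    (hIα : DForm.HasMDiffCoeff (iota I α)) (hIβ : DForm.HasMDiffCoeff (iota I β)) :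
    dTwist I (complexForm α β) = complexForm (dTwist I α) (dTwist I β) := by
  funext x
  unfold dTwist
  rw [iota_complexForm, dExt_complexForm hα hβ, dExt_complexForm hIα hIβ, iota_complexForm,
    complexForm_sub]

/-- If `d α = d_I β` and `d β = - d_I α`, then `∂_I (α + i β) = 0`. -/
lemma del_complexForm_eq_zero {n : ℕ} (I : EndField E M) {α β : DForm E M ℝ n}
    (hα : α.HasMDiffCoeff) (hβ : β.HasMDiffCoeff)
    (hIα : DForm.HasMDiffCoeff (iota I α)) (hIβ : DForm.HasMDiffCoeff (iota I β))
    (h1 : dExt α = dTwist I β) (h2 : dExt β = -dTwist I α) :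
    del I (complexForm α β) = 0 := by
  have h3 : dTwist I α = -dExt β := by rw [h2, neg_neg]
  funext x
  unfold del
  rw [dTwist_complexForm I hα hβ hIα hIβ, dExt_complexForm hα hβ, h3, ← h1]
  ext v
  change (1 / 2 : ℂ) * (complexForm (dExt α) (dExt β) x v +
    Complex.I * complexForm (-dExt β) (dExt α) x v) = 0
  rw [complexForm_apply, complexForm_apply, Pi.neg_apply, ContinuousAlternatingMap.neg_apply,
    Complex.ofReal_neg]
  linear_combination (1 / 2 : ℂ) * (dExt α x v : ℂ) * Complex.I_mul_I

end ComplexForms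

/-! ### Quaternionic identities and the HKT conclusions. -/

section Hyperhermitian

variable {E : Type*} [NormedAddCommGroup E] [NormedSpace ℝ E]
  {M : Type*} [TopologicalSpace M] [ChartedSpace E M] [IsManifold 𝓘(ℝ, E) ∞ M]
  {g : Metric E M} {I J K : EndField E M}

namespace IsHypercomplex

lemma mul_JI (h : IsHypercomplex I J K) (x : M)
    (v : TangentSpace 𝓘(ℝ, E) x) : J x (I x v) = -K x v := by
  rw [← h.mul_JK x v, h.complex_J.sq_eq_neg]

lemma mul_KJ (h : IsHypercomplex I J K) (x : M)
    (v : TangentSpace 𝓘(ℝ, E) x) : K x (J x v) = -I x v := by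
  rw [← h.mul_KI x v, h.complex_K.sq_eq_neg]

lemma mul_IK (h : IsHypercomplex I J K) (x : M)
    (v : TangentSpace 𝓘(ℝ, E) x) : I x (K x v) = -J x v := by
  rw [← h.mul_IJ x v, h.complex_I.sq_eq_neg]

end IsHypercomplex

namespace IsHKT

/-- Both terms of `ι_I Ω_J` equal `-Ω_K`: one from `JI = -K`, the other from `IJ = K` once `I` is
moved across `g`. Together with its companion for `K`, this says that `ι_I` multiplies `Ω_J + iΩ_K`
by `2i`. -/
lemma iota_fundForm_J [FiniteDimensional ℝ E] (h : IsHKT g I J K) :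
    iota I (fundForm g J) = fun x ↦ (-2 : ℝ) • fundForm g K x := by
  have hc := h.hypercomplex
  funext x
  ext v
  change iotaAt (I x) (fundForm g J x) v = -2 * fundForm g K x v
  rw [iotaAt_apply, Fin.sum_univ_two, fundForm_apply h.hermitian_J hc.complex_J,
    fundForm_apply h.hermitian_J hc.complex_J, fundForm_apply h.hermitian_K hc.complex_K]
  have h1 := h.hermitian_I.inner_apply_right hc.complex_I x (v 0) (J x (v 1))
  rw [hc.mul_IJ] at h1
  simp only [Function.update_self, ne_eq, zero_ne_one, one_ne_zero, not_false_eq_true,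
    Function.update_of_ne, hc.mul_JI, map_neg]
  linarith

lemma iota_fundForm_K [FiniteDimensional ℝ E] (h : IsHKT g I J K) :
    iota I (fundForm g K) = fun x ↦ (2 : ℝ) • fundForm g J x := by
  have hc := h.hypercomplex
  funext x
  ext v
  change iotaAt (I x) (fundForm g K x) v = 2 * fundForm g J x v
  rw [iotaAt_apply, Fin.sum_univ_two, fundForm_apply h.hermitian_K hc.complex_K,
    fundForm_apply h.hermitian_K hc.complex_K, fundForm_apply h.hermitian_J hc.complex_J]
  have h1 := h.hermitian_I.inner_apply_right hc.complex_I x (v 0) (K x (v 1))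
  rw [hc.mul_IK, map_neg] at h1
  simp only [Function.update_self, ne_eq, zero_ne_one, one_ne_zero, not_false_eq_true,
    Function.update_of_ne, hc.mul_KI]
  linarith

lemma isOfType_holForm [FiniteDimensional ℝ E] (h : IsHKT g I J K) :
    IsOfType I 2 0 (holForm g J K) := by
  have hc := h.hypercomplex
  refine ⟨rfl, fun x a b v ↦ ?_⟩
  change complexForm (fundForm g J) (fundForm g K) x _ =
    _ * complexForm (fundForm g J) (fundForm g K) x v
  have h1 := h.hermitian_I.inner_apply_right hc.complex_I x (v 0) (J x (v 1))
  have h2 := h.hermitian_I.inner_apply_right hc.complex_I x (v 0) (K x (v 1))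
  simp only [hc.mul_IJ, hc.mul_IK, map_neg] at h1 h2
  have hJ : fundForm g J x (fun i ↦ a • v i + b • I x (v i)) =
      (a ^ 2 - b ^ 2) * fundForm g J x v - 2 * a * b * fundForm g K x v := by
    simp only [fundForm_apply h.hermitian_J hc.complex_J,
      fundForm_apply h.hermitian_K hc.complex_K, map_add, map_smul, _root_.add_apply,
      _root_.smul_apply, smul_eq_mul, hc.mul_JI, map_neg]
    linear_combination (2 * a * b) * h1 - 2 * b ^ 2 * h2
  have hK : fundForm g K x (fun i ↦ a • v i + b • I x (v i)) =
      (a ^ 2 - b ^ 2) * fundForm g K x v + 2 * a * b * fundForm g J x v := by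
    simp only [fundForm_apply h.hermitian_J hc.complex_J,
      fundForm_apply h.hermitian_K hc.complex_K, map_add, map_smul, _root_.add_apply,
      _root_.smul_apply, smul_eq_mul, hc.mul_KI]
    linear_combination (2 * a * b) * h2 + 2 * b ^ 2 * h1
  rw [complexForm_apply, complexForm_apply, hJ, hK]
  push_cast
  linear_combination (-(b : ℂ) ^ 2 * (fundForm g J x v + Complex.I * fundForm g K x v) -
    2 * a * b * fundForm g K x v) * Complex.I_mul_I

variable [FiniteDimensional ℝ E]

/-- The exterior derivatives of the fundamental forms of `J` and `K` are trilinear forms which are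
rotated into each other by `I`. -/
lemma exists_dExt_fundForm (h : IsHKT g I J K) (x : M) :
    ∃ s t : TangentSpace 𝓘(ℝ, E) x → TangentSpace 𝓘(ℝ, E) x → TangentSpace 𝓘(ℝ, E) x → ℝ,
      IsTrilinear s ∧ IsTrilinear t ∧
      (∀ v, dExt (fundForm g J) x v = s (v 0) (v 1) (v 2)) ∧
      (∀ v, dExt (fundForm g K) x v = t (v 0) (v 1) (v 2)) ∧
      (∀ u v w, triIota (I x) s u v w = -t u v w) ∧
      (∀ u v w, triIota (I x) t u v w = s u v w) := by
  have hc := h.hypercomplex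
  obtain ⟨C, ⟨cI, bI, eI⟩, ⟨cJ, bJ, eJ⟩, ⟨cK, bK, eK⟩⟩ := h.same_torsion
  have eI' : loweredTorsion g cI x = C x := by funext u v w; exact (eI x u v w).symm
  have eJ' : loweredTorsion g cJ x = C x := by funext u v w; exact (eJ x u v w).symm
  have eK' : loweredTorsion g cK x = C x := by funext u v w; exact (eK x u v w).symm
  have hC : IsTrilinear (C x) := eI' ▸ isTrilinear_loweredTorsion g cI x
  have mI : IsMixedType (I x) (C x) := eI' ▸ bI.isMixedType h.hermitian_I hc.complex_I x
  have mJ : IsMixedType (J x) (C x) := eJ' ▸ bJ.isMixedType h.hermitian_J hc.complex_J x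
  have mK : IsMixedType (K x) (C x) := eK' ▸ bK.isMixedType h.hermitian_K hc.complex_K x
  refine ⟨fun u v w ↦ 2 * triIota (J x) (C x) u v w, fun u v w ↦ 2 * triIota (K x) (C x) u v w,
    (hC.triIota _).const_mul 2, (hC.triIota _).const_mul 2, fun v ↦ ?_, fun v ↦ ?_,
    fun u v w ↦ ?_, fun u v w ↦ ?_⟩
  · rw [bJ.dExt_fundForm_apply h.hermitian_J hc.complex_J, eJ']
    rfl
  · rw [bK.dExt_fundForm_apply h.hermitian_K hc.complex_K, eK']
    rfl
  · have := hC.triIota_triIota_neg (hc.complex_K.sq_eq_neg x) (hc.mul_IK x) (hc.mul_JK x)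
      (hc.mul_JI x) mI mJ mK u v w
    rw [triIota] at this ⊢
    linarith
  · have := hC.triIota_triIota (hc.complex_J.sq_eq_neg x) (hc.mul_KJ x) (hc.mul_IJ x)
      (hc.mul_KI x) mI mJ mK u v w
    rw [triIota] at this ⊢
    linarith

lemma iota_dExt_fundForm_J (h : IsHKT g I J K) :
    iota I (dExt (fundForm g J)) = -dExt (fundForm g K) := by
  funext x
  obtain ⟨s, t, -, -, hJ, hK, hs, -⟩ := h.exists_dExt_fundForm x
  ext v
  exact (iotaAt_apply_three hJ v).trans ((hs _ _ _).trans (congrArg Neg.neg (hK v).symm))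

lemma iota_dExt_fundForm_K (h : IsHKT g I J K) :
    iota I (dExt (fundForm g K)) = dExt (fundForm g J) := by
  funext x
  obtain ⟨s, t, -, -, hJ, hK, -, ht⟩ := h.exists_dExt_fundForm x
  ext v
  exact (iotaAt_apply_three hK v).trans ((ht _ _ _).trans (hJ v).symm)

/-- The factor 2 from `ι` on `Ω_K` against the factor 1 from `ι` on `dΩ_K` leaves exactly one
`dΩ_J`. -/
lemma dExt_fundForm_J (h : IsHKT g I J K) : dExt (fundForm g J) = dTwist I (fundForm g K) := by
  funext x
  unfold dTwist
  rw [h.iota_fundForm_K, h.iota_dExt_fundForm_K, dExt_smul]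
  dsimp only
  rw [two_smul, add_sub_cancel_right]

lemma dExt_fundForm_K (h : IsHKT g I J K) : dExt (fundForm g K) = -dTwist I (fundForm g J) := by
  funext x
  rw [Pi.neg_apply]
  unfold dTwist
  rw [h.iota_fundForm_J, h.iota_dExt_fundForm_J, dExt_smul]
  dsimp only
  rw [neg_smul, two_smul, Pi.neg_apply]
  abel

lemma dExt_holForm (h : IsHKT g I J K) :
    dExt (holForm g J K) = complexForm (dExt (fundForm g J)) (dExt (fundForm g K)) :=
  have : CompleteSpace E := FiniteDimensional.complete ℝ E
  dExt_complexForm (fundForm_hasMDiffCoeff h.hermitian_J h.hypercomplex.complex_J)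
    (fundForm_hasMDiffCoeff h.hermitian_K h.hypercomplex.complex_K)

lemma isOfType_dExt_holForm (h : IsHKT g I J K) : IsOfType I 2 1 (dExt (holForm g J K)) := by
  refine ⟨rfl, fun x a b v ↦ ?_⟩
  obtain ⟨s, t, hs, ht, hJ, hK, hst, hts⟩ := h.exists_dExt_fundForm x
  have hII := h.hypercomplex.complex_I.sq_eq_neg x
  have h1 := hs.apply_complexMul hII hst hts a b (v 0) (v 1) (v 2)
  -- The imaginary part is handled by the pair `(t, -s)`: `t - i s = -i (s + i t)` is an eigenvector
  -- with the same eigenvalue `i`.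
  have hsn : ∀ u v w, triIota (I x) (fun u v w ↦ -s u v w) u v w = t u v w := by
    intro u v w
    rw [← neg_neg (t u v w), ← hst, triIota, triIota]
    ring
  have h2 := ht.apply_complexMul hII (fun u v w ↦ (hts u v w).trans (neg_neg _).symm) hsn a b
    (v 0) (v 1) (v 2)
  rw [h.dExt_holForm, complexForm_apply, complexForm_apply, hJ, hK, hJ, hK, h1, h2]
  push_cast
  -- The scalar identity behind this is `(a + bi)² (a - bi) = (a² + b²)(a + bi)`.
  linear_combination (a * b ^ 2 * (s (v 0) (v 1) (v 2) + t (v 0) (v 1) (v 2) * Complex.I) -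
    a ^ 2 * b * t (v 0) (v 1) (v 2) + b ^ 3 * (s (v 0) (v 1) (v 2) * Complex.I +
    t (v 0) (v 1) (v 2) * (Complex.I * Complex.I - 1)) : ℂ) * Complex.I_mul_I

lemma del_holForm (h : IsHKT g I J K) : del I (holForm g J K) = 0 := by
  have : CompleteSpace E := FiniteDimensional.complete ℝ E
  have hJ := fundForm_hasMDiffCoeff h.hermitian_J h.hypercomplex.complex_J
  have hK := fundForm_hasMDiffCoeff h.hermitian_K h.hypercomplex.complex_K
  refine del_complexForm_eq_zero I hJ hK ?_ ?_ h.dExt_fundForm_J h.dExt_fundForm_K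
  · rw [h.iota_fundForm_J]
    exact hK.const_smul _
  · rw [h.iota_fundForm_K]
    exact hJ.const_smul _

end IsHKT

end Hyperhermitian

end HKT

end

theorem mainTheorem1
    {E : Type*} [NormedAddCommGroup E] [NormedSpace ℝ E] [FiniteDimensional ℝ E]
    {M : Type*} [TopologicalSpace M] [ChartedSpace E M] [IsManifold 𝓘(ℝ, E) ∞ M]
    (g : HKT.Metric E M) (I J K : HKT.EndField E M) (h : HKT.IsHKT g I J K) :
    HKT.IsOfType I 2 0 (HKT.holForm g J K) ∧
    HKT.IsOfType I 2 1 (HKT.dExt (HKT.holForm g J K)) ∧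
    HKT.del I (HKT.holForm g J K) = 0 ∧
    HKT.dExt (HKT.fundForm g J) = HKT.dTwist I (HKT.fundForm g K) ∧
    HKT.dExt (HKT.fundForm g K) = -HKT.dTwist I (HKT.fundForm g J) := by
  exact ⟨h.isOfType_holForm, h.isOfType_dExt_holForm, h.del_holForm, h.dExt_fundForm_J,
    h.dExt_fundForm_K⟩
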